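/- Let $N\ge 1$ be an integer and let $\beta>0$, $a>-1$, $b>-1$ be real numbers. The $\beta$-Jacobi ensemble is the probability measure on $(0,1)^N$ whose density with respect to Lebesgue measure is proportional to $$\prod_{l=1}^N x_l^a(1-x_l)^b\prod_{1\le j<k\le N}|x_k-x_j|^\beta$$ (this function has finite, positive integral, so the measure is well defined). For $k\ge 0$ let $$m_k=\Big\langle\Big(\sum_{j=1}^N x_j\Big)^k\Big\rangle$$ be the $k$-th moment of the trace in this ensemble; all these moments exist. Put $$u_1=\tfrac{\beta}{2}(N-1)+a+1,\qquad u_2=\beta(N-1)+a+b+2.$$ Then $$m_1=\frac{Nu_1}{u_2},$$ $$m_2=\frac{N(N-1)}{1+\beta/2}\,\frac{u_1(u_1-\beta/2)}{u_2(u_2-\beta/2)}+\frac{N(1+\beta N/2)}{1+\beta/2}\,\frac{u_1(u_1+1)}{u_2(u_2+1)},$$ $$m_3=\frac{N(N-1)(N-2)}{(1+\beta/2)(1+\beta)}\,\frac{u_1(u_1-\beta/2)(u_1-\beta)}{u_2(u_2-\beta/2)(u_2-\beta)}+3\,\frac{N(N-1)(1+\beta N/2)}{(1+\beta/4)(1+\beta)}\,\frac{u_1(u_1+1)(u_1-\beta/2)}{u_2(u_2+1)(u_2-\beta/2)}+\frac{N(1+\beta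 N/4)(1+\beta N/2)}{(1+\beta/4)(1+\beta/2)}\,\frac{u_1(u_1+1)(u_1+2)}{u_2(u_2+1)(u_2+2)}.$$ Here a summand whose prefactor $N(N-1)$ or $N(N-1)(N-2)$ is zero is read as $0$; in all other summands the denominators are positive. -/

import Mathlib

open MeasureTheory

noncomputable section

/-- The Jacobi weight `w(x) = x ^ a * (1 - x) ^ b` on `0 < x < 1`, extended by zero. -/
def jacobiWeight (a b : ℝ) : ℝ → ℝ :=
  Set.indicator (Set.Ioo 0 1) fun x => x ^ a * (1 - x) ^ b

/-- The unnormalised eigenvalue density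
`∏ l, w (x l) * ∏_{j < k} |x k - x j| ^ β` of the `β`-Jacobi ensemble on `ℝ ^ N`. -/
def jacobiDensity (N : ℕ) (β a b : ℝ) (x : Fin N → ℝ) : ℝ :=
  (∏ l, jacobiWeight a b (x l)) * ∏ j, ∏ k ∈ Finset.Ioi j, |x k - x j| ^ β

/-- The measure on `ℝ ^ N` with density `jacobiDensity N β a b` (no normalisation);
its total mass is the Selberg integral. -/
def jacobiUnnormalized (N : ℕ) (β a b : ℝ) : Measure (Fin N → ℝ) :=
  volume.withDensity fun x => ENNReal.ofReal (jacobiDensity N β a b x)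

/-- The `β`-Jacobi ensemble: the normalised joint law of the `N` eigenvalues. -/
def jacobiEnsemble (N : ℕ) (β a b : ℝ) : Measure (Fin N → ℝ) :=
  (jacobiUnnormalized N β a b Set.univ)⁻¹ • jacobiUnnormalized N β a b

/-- The `k`-th moment of the trace `x 1 + ⋯ + x N` in the `β`-Jacobi ensemble. -/
def jacobiTraceMoment (N : ℕ) (β a b : ℝ) (k : ℕ) : ℝ :=
  ProbabilityTheory.moment (fun x : Fin N → ℝ => ∑ j, x j) k (jacobiEnsemble N β a b)

end

/-! The moments come from loop equations (Schwinger–Dyson identities). Move every coordinate by `x ↦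
x + t x (1 - x) r x`. This fixes `0` and `1` and multiplies each of `x`, `1 - x` and `x k - x j` by
a factor `1 + t * (...)`, so for small `t` the cube is mapped to itself and the density changes by
the factor `jacobiFlowFactor`, which is smooth near `t = 0`. The singularities of the weight and of
`|x k - x j| ^ β` are never differentiated and no boundary terms arise. The integral does not depend
on `t`; its derivative at `0` gives `jacobi_loop_equation`.

Taking `r = 1` and `r = x` against power sums `p₁`, `p₂` gives six linear relations among the means
of `p₁`, `p₁²`, `p₂`, `p₁³`, `p₁p₂`, `p₃` (`jacobi_powerSum_moment_equations`). Elimination yields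
the three moments when `N ≥ 2`. For `N = 1` the factors `u₂ - β / 2` and `u₂ - β` may vanish, and a
direct recursion is used instead. -/

/-! ### Calculus preliminaries. -/

open Filter Topology in
/-- Differentiation under the integral sign at `0` for a family that is jointly `C¹` near
`{0} × K`, where `K` is a compact set carrying the finite measure `μ`. -/
theorem hasDerivAt_integral_of_contDiffAt_of_isCompact {E : Type*} [NormedAddCommGroup E]
    [NormedSpace ℝ E] [MeasurableSpace E] [BorelSpace E]
    {μ : Measure E} [IsFiniteMeasure μ] {K : Set E} (hK : IsCompact K) (hμ : ∀ᵐ x ∂μ, x ∈ K)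
    {G : ℝ → E → ℝ} {G' : E → ℝ} (hG : ∀ x ∈ K, ContDiffAt ℝ 1 (Function.uncurry G) (0, x))
    (hG' : ∀ x ∈ K, HasDerivAt (fun t => G t x) (G' x) 0) :
    HasDerivAt (fun t => ∫ x, G t x ∂μ) (∫ x, G' x ∂μ) 0 := by
  set D : ℝ × E → ℝ := fun p => fderiv ℝ (Function.uncurry G) p (1, 0) with hD
  have hrestr : μ.restrict K = μ := Measure.restrict_eq_self_of_ae_mem hμ
  have hDat : ∀ p : ℝ × E, ContDiffAt ℝ 1 (Function.uncurry G) p → ContinuousAt D p := by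
    intro p hp
    exact (hp.continuousAt_fderiv one_ne_zero).clm_apply continuousAt_const
  have hderiv : ∀ t x, ContDiffAt ℝ 1 (Function.uncurry G) (t, x) →
      HasDerivAt (fun s => G s x) (D (t, x)) t := by
    intro t x hp
    have h1 := (hp.differentiableAt one_ne_zero).hasFDerivAt
    have h2 : HasDerivAt (fun s : ℝ => (s, x)) ((1 : ℝ), (0 : E)) t :=
      (hasDerivAt_id t).prodMk (hasDerivAt_const t x)
    exact h1.comp_hasDerivAt t h2
  have hslice : ∀ t, (∀ x ∈ K, ContDiffAt ℝ 1 (Function.uncurry G) (t, x)) →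
      ContinuousOn (G t) K ∧ ContinuousOn (fun x => D (t, x)) K := by
    intro t h
    refine ⟨fun x hx => ?_, fun x hx => ?_⟩
    · have : ContinuousAt (Function.uncurry G ∘ fun y => (t, y)) x :=
        ContinuousAt.comp (h x hx).continuousAt (by fun_prop)
      exact this.continuousWithinAt
    · have : ContinuousAt (D ∘ fun y => (t, y)) x :=
        ContinuousAt.comp (hDat _ (h x hx)) (by fun_prop)
      exact this.continuousWithinAt
  have hmeas : ∀ f : E → ℝ, ContinuousOn f K → AEStronglyMeasurable f μ := by
    intro f hf
    rw [← hrestr]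
    exact hf.aestronglyMeasurable_of_isCompact hK hK.isClosed.measurableSet
  have hint : ∀ f : E → ℝ, ContinuousOn f K → Integrable f μ := by
    intro f hf
    obtain ⟨C, hC⟩ := hK.exists_bound_of_continuousOn hf
    exact Integrable.of_bound (hmeas f hf) C (hμ.mono hC)
  obtain ⟨C, hC⟩ := hK.exists_bound_of_continuousOn (hslice 0 hG).2
  -- Compactness of `K` makes the neighbourhood of `t = 0` uniform in `x`; the bound `C` at `t = 0`
  -- loosens to `C + 1`.
  have hev : ∀ᶠ t in 𝓝 (0 : ℝ), ∀ x ∈ K,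
      ContDiffAt ℝ 1 (Function.uncurry G) (t, x) ∧ ‖D (t, x)‖ ≤ C + 1 := by
    refine hK.eventually_forall_of_forall_eventually fun x hx => ?_
    have h1 : ∀ᶠ p in 𝓝 ((0 : ℝ), x), ContDiffAt ℝ 1 (Function.uncurry G) p :=
      (hG x hx).eventually (by simp)
    have h2 : ∀ᶠ p in 𝓝 ((0 : ℝ), x), ‖D p‖ < C + 1 :=
      (hDat _ (hG x hx)).norm.eventually_lt continuousAt_const
        (lt_of_le_of_lt (hC x hx) (lt_add_one C))
    filter_upwards [h1, h2] with p hp1 hp2 using ⟨hp1, hp2.le⟩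
  have key := (hasDerivAt_integral_of_dominated_loc_of_deriv_le (μ := μ) (F := G)
    (F' := fun t x => D (t, x)) (x₀ := 0) (bound := fun _ => C + 1) hev
    (hev.mono fun t ht => hmeas _ (hslice t fun x hx => (ht x hx).1).1)
    (hint _ (hslice 0 hG).1) (hmeas _ (hslice 0 hG).2)
    (hμ.mono fun x hx t ht => (ht x hx).2) (integrable_const _)
    (hμ.mono fun x hx t ht => hderiv t x (ht x hx).1)).2
  have heq : ∫ x, G' x ∂μ = ∫ x, D (0, x) ∂μ :=
    integral_congr_ae (hμ.mono fun x hx => (hG' x hx).unique (hderiv 0 x (hG x hx)))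
  rwa [heq]

/-- Logarithmic derivative of a product all of whose factors equal `1` at the base point. -/
theorem HasDerivAt.finset_prod_of_eq_one {ι : Type*} {s : Finset ι} {f : ι → ℝ → ℝ}
    {f' : ι → ℝ} {t : ℝ} (hf : ∀ i ∈ s, HasDerivAt (f i) (f' i) t) (h1 : ∀ i ∈ s, f i t = 1) :
    HasDerivAt (fun u => ∏ i ∈ s, f i u) (∑ i ∈ s, f' i) t := by
  classical
  have h := HasDerivAt.fun_finsetProd hf
  rwa [Finset.sum_congr rfl fun i _ => by
    rw [Finset.prod_eq_one fun j hj => h1 j (Finset.mem_of_mem_erase hj), one_smul]] at h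

/-! ### Positivity and integrability of the Jacobi density. -/

theorem jacobiWeight_nonneg (a b x : ℝ) : 0 ≤ jacobiWeight a b x :=
  Set.indicator_nonneg (fun _ hy => mul_nonneg (Real.rpow_nonneg hy.1.le _)
    (Real.rpow_nonneg (sub_nonneg.2 hy.2.le) _)) x

theorem jacobiWeight_of_mem {a b x : ℝ} (hx : x ∈ Set.Ioo (0 : ℝ) 1) :
    jacobiWeight a b x = x ^ a * (1 - x) ^ b :=
  Set.indicator_of_mem hx _

theorem measurable_jacobiWeight (a b : ℝ) : Measurable (jacobiWeight a b) :=
  Measurable.indicator (by fun_prop) measurableSet_Ioo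

-- The weight is a constant multiple of the Beta density with parameters `a + 1`, `b + 1`.
open ProbabilityTheory in
theorem integrable_jacobiWeight {a b : ℝ} (ha : -1 < a) (hb : -1 < b) :
    Integrable (jacobiWeight a b) := by
  have ha' : 0 < a + 1 := by linarith
  have hb' : 0 < b + 1 := by linarith
  have h0 : 0 ≤ᵐ[volume] betaPDFReal (a + 1) (b + 1) := by
    refine Filter.Eventually.of_forall fun x => ?_
    by_cases hx : 0 < x ∧ x < 1
    · exact (betaPDFReal_pos hx.1 hx.2 ha' hb').le
    · simp [betaPDFReal, hx]
  have h1 : Integrable (betaPDFReal (a + 1) (b + 1)) := by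
    refine ⟨(measurable_betaPDFReal _ _).aestronglyMeasurable, ?_⟩
    rw [hasFiniteIntegral_iff_ofReal h0]
    have := lintegral_betaPDF_eq_one ha' hb'
    simp only [betaPDF] at this
    rw [this]
    exact ENNReal.one_lt_top
  convert h1.const_mul (beta (a + 1) (b + 1)) using 1
  funext x
  have hB := (beta_pos ha' hb').ne'
  by_cases hx : 0 < x ∧ x < 1
  · rw [jacobiWeight_of_mem hx, betaPDFReal, if_pos hx]
    field_simp
    simp
  · rw [betaPDFReal, if_neg hx, mul_zero]
    exact Set.indicator_of_notMem (s := Set.Ioo (0 : ℝ) 1) hx _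

/-- The open unit cube. -/
def openUnitCube (N : ℕ) : Set (Fin N → ℝ) := Set.univ.pi fun _ => Set.Ioo 0 1

theorem mem_openUnitCube {N : ℕ} {x : Fin N → ℝ} :
    x ∈ openUnitCube N ↔ ∀ i, x i ∈ Set.Ioo (0 : ℝ) 1 := by
  simp [openUnitCube]

theorem isOpen_openUnitCube (N : ℕ) : IsOpen (openUnitCube N) :=
  isOpen_set_pi Set.finite_univ fun _ _ => isOpen_Ioo

theorem jacobiDensity_nonneg (N : ℕ) (β a b : ℝ) (x : Fin N → ℝ) :
    0 ≤ jacobiDensity N β a b x :=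
  mul_nonneg (Finset.prod_nonneg fun _ _ => jacobiWeight_nonneg _ _ _)
    (Finset.prod_nonneg fun _ _ => Finset.prod_nonneg fun _ _ =>
      Real.rpow_nonneg (abs_nonneg _) _)

theorem jacobiDensity_of_notMem {N : ℕ} {β a b : ℝ} {x : Fin N → ℝ} (hx : x ∉ openUnitCube N) :
    jacobiDensity N β a b x = 0 := by
  rw [mem_openUnitCube] at hx
  push Not at hx
  obtain ⟨i, hi⟩ := hx
  rw [jacobiDensity, Finset.prod_eq_zero (Finset.mem_univ i), zero_mul]
  exact Set.indicator_of_notMem hi _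

theorem jacobiDensity_pos {N : ℕ} {β a b : ℝ} {x : Fin N → ℝ} (hx : x ∈ openUnitCube N)
    (hinj : Function.Injective x) : 0 < jacobiDensity N β a b x := by
  rw [mem_openUnitCube] at hx
  refine mul_pos (Finset.prod_pos fun i _ => ?_)
    (Finset.prod_pos fun j _ => Finset.prod_pos fun k hk => ?_)
  · rw [jacobiWeight_of_mem (hx i)]
    exact mul_pos (Real.rpow_pos_of_pos (hx i).1 _) (Real.rpow_pos_of_pos (by linarith [(hx i).2]) _)
  · refine Real.rpow_pos_of_pos (abs_pos.2 (sub_ne_zero.2 fun h => ?_)) _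
    exact (Finset.mem_Ioi.1 hk).ne' (hinj h)

theorem measurable_jacobiDensity (N : ℕ) (β a b : ℝ) : Measurable (jacobiDensity N β a b) := by
  unfold jacobiDensity
  refine Measurable.mul ?_ ?_
  · exact Finset.measurable_fun_prod _ fun i _ =>
      (measurable_jacobiWeight a b).comp (measurable_pi_apply i)
  · exact Finset.measurable_fun_prod _ fun j _ => Finset.measurable_fun_prod _ fun k _ => by fun_prop

/-- On the cube `|x k - x j| ≤ 1`, so for `β ≥ 0` the interaction is at most `1` and the product of
weights dominates. -/
theorem integrable_jacobiDensity (N : ℕ) {β a b : ℝ} (hβ : 0 ≤ β) (ha : -1 < a) (hb : -1 < b) :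
    Integrable (jacobiDensity N β a b) := by
  have h : Integrable fun x : Fin N → ℝ => ∏ i, jacobiWeight a b (x i) :=
    Integrable.fintype_prod fun _ => integrable_jacobiWeight ha hb
  refine h.mono (measurable_jacobiDensity N β a b).aestronglyMeasurable
    (Filter.Eventually.of_forall fun x => ?_)
  rw [Real.norm_of_nonneg (jacobiDensity_nonneg _ _ _ _ _),
    Real.norm_of_nonneg (Finset.prod_nonneg fun _ _ => jacobiWeight_nonneg _ _ _)]
  by_cases hx : x ∈ openUnitCube N
  · rw [mem_openUnitCube] at hx
    refine mul_le_of_le_one_right (Finset.prod_nonneg fun _ _ => jacobiWeight_nonneg _ _ _) ?_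
    refine Finset.prod_le_one (fun _ _ => Finset.prod_nonneg fun _ _ =>
      Real.rpow_nonneg (abs_nonneg _) _) fun j _ => Finset.prod_le_one (fun _ _ =>
      Real.rpow_nonneg (abs_nonneg _) _) fun k _ => Real.rpow_le_one (abs_nonneg _) ?_ hβ
    rw [abs_le]
    constructor <;> linarith [(hx j).1, (hx j).2, (hx k).1, (hx k).2]
  · rw [jacobiDensity_of_notMem hx]
    exact Finset.prod_nonneg fun _ _ => jacobiWeight_nonneg _ _ _

theorem isFiniteMeasure_jacobiUnnormalized (N : ℕ) {β a b : ℝ} (hβ : 0 ≤ β) (ha : -1 < a)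
    (hb : -1 < b) : IsFiniteMeasure (jacobiUnnormalized N β a b) :=
  isFiniteMeasure_withDensity_ofReal (integrable_jacobiDensity N hβ ha hb).2

theorem jacobiUnnormalized_univ_ne_zero (N : ℕ) (β a b : ℝ) :
    jacobiUnnormalized N β a b Set.univ ≠ 0 := by
  have hm : Measurable fun x : Fin N → ℝ => ENNReal.ofReal (jacobiDensity N β a b x) :=
    (measurable_jacobiDensity N β a b).ennreal_ofReal
  rw [jacobiUnnormalized, withDensity_apply _ MeasurableSet.univ, Measure.restrict_univ,
    ← pos_iff_ne_zero, lintegral_pos_iff_support hm]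
  -- The density is positive at points of the cube with distinct coordinates, and these form a
  -- nonempty open set.
  set S : Set (Fin N → ℝ) := openUnitCube N ∩ {x | Function.Injective x}
  have hopen : IsOpen S := by
    refine (isOpen_openUnitCube N).inter ?_
    have : {x : Fin N → ℝ | Function.Injective x} = ⋂ i, ⋂ j, {x | i ≠ j → x i ≠ x j} := by
      ext x
      simp only [Set.mem_ofPred_eq, Set.mem_iInter, Function.Injective]
      exact forall₂_congr fun i j => not_imp_not.symm
    rw [this]
    refine isOpen_iInter_of_finite fun i => isOpen_iInter_of_finite fun j => ?_
    by_cases hij : i = j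
    · simp [hij]
    · simp only [ne_eq, hij, not_false_eq_true, forall_const]
      exact isOpen_ne_fun (continuous_apply i) (continuous_apply j)
  have hne : S.Nonempty := by
    refine ⟨fun i => ((i : ℝ) + 1) / (N + 1), mem_openUnitCube.2 fun i => ⟨by positivity, ?_⟩, ?_⟩
    · rw [div_lt_one (by positivity)]
      exact_mod_cast Nat.succ_lt_succ i.2
    · intro i j hij
      have hN : (N : ℝ) + 1 ≠ 0 := by positivity
      have : ((i : ℕ) : ℝ) = (j : ℕ) := by simpa [div_left_inj' hN] using hij
      exact Fin.ext (by exact_mod_cast this)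
  refine (hopen.measure_pos volume hne).trans_le (measure_mono fun x hx => ?_)
  exact (ENNReal.ofReal_pos.2 (jacobiDensity_pos hx.1 hx.2)).ne'

theorem ae_jacobiUnnormalized_mem_openUnitCube (N : ℕ) (β a b : ℝ) :
    ∀ᵐ x ∂jacobiUnnormalized N β a b, x ∈ openUnitCube N := by
  rw [jacobiUnnormalized,
    ae_withDensity_iff (measurable_jacobiDensity N β a b).ennreal_ofReal]
  refine Filter.Eventually.of_forall fun x hx => ?_
  by_contra h
  simp [jacobiDensity_of_notMem h] at hx

theorem integral_jacobiUnnormalized (N : ℕ) (β a b : ℝ) (F : (Fin N → ℝ) → ℝ) :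
    ∫ x, F x ∂jacobiUnnormalized N β a b =
      ∫ x in openUnitCube N, jacobiDensity N β a b x * F x := by
  rw [jacobiUnnormalized, integral_withDensity_eq_integral_toReal_smul
    (measurable_jacobiDensity N β a b).ennreal_ofReal (by simp)]
  rw [setIntegral_eq_integral_of_forall_compl_eq_zero]
  · simp only [ENNReal.toReal_ofReal (jacobiDensity_nonneg _ _ _ _ _), smul_eq_mul]
  · intro x hx
    rw [jacobiDensity_of_notMem hx, zero_mul]

/-! ### The endpoint-fixing flow and its change of variables. -/

/-- The family of maps `x ↦ x + t x (1 - x) r x`, fixing `0` and `1`. -/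
def endpointFlow (r : ℝ → ℝ) (t x : ℝ) : ℝ := x + t * (x * (1 - x) * r x)

/-- The factor by which the Jacobi density, times Lebesgue measure, changes under
`endpointFlow r t` applied to every coordinate, where `q` is the divided difference of
`x (1 - x) r x`. -/
noncomputable def jacobiFlowFactor (N : ℕ) (β a b : ℝ) (r : ℝ → ℝ) (q : ℝ → ℝ → ℝ) (t : ℝ)
    (x : Fin N → ℝ) : ℝ :=
  (∏ i, (1 + t * ((1 - x i) * r (x i))) ^ a * (1 + t * (-(x i * r (x i)))) ^ b
      * (1 + t * q (x i) (x i)))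
    * ∏ j, ∏ k ∈ Finset.Ioi j, (1 + t * q (x k) (x j)) ^ β

/-- The parameter `t` is so small that `endpointFlow r t` is a diffeomorphism of `[0, 1]`. -/
def IsSmallFlowTime (r : ℝ → ℝ) (q : ℝ → ℝ → ℝ) (t : ℝ) : Prop :=
  ∀ x ∈ Set.Icc (0 : ℝ) 1, ∀ y ∈ Set.Icc (0 : ℝ) 1,
    0 < 1 + t * ((1 - x) * r x) ∧ 0 < 1 + t * (-(x * r x)) ∧ 0 < 1 + t * q x y

open Filter Topology in
theorem eventually_isSmallFlowTime {r : ℝ → ℝ} {q : ℝ → ℝ → ℝ} (hr : Continuous r)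
    (hq : Continuous (Function.uncurry q)) : ∀ᶠ t in 𝓝 (0 : ℝ), IsSmallFlowTime r q t := by
  have hK : IsCompact (Set.Icc (0 : ℝ) 1 ×ˢ Set.Icc (0 : ℝ) 1) := isCompact_Icc.prod isCompact_Icc
  have h : ∀ᶠ t in 𝓝 (0 : ℝ), ∀ p ∈ Set.Icc (0 : ℝ) 1 ×ˢ Set.Icc (0 : ℝ) 1,
      0 < 1 + t * ((1 - p.1) * r p.1) ∧ 0 < 1 + t * (-(p.1 * r p.1)) ∧
        0 < 1 + t * Function.uncurry q p := by
    refine hK.eventually_forall_of_forall_eventually fun p _ => ?_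
    have key : ∀ g : ℝ × ℝ → ℝ, Continuous g →
        ∀ᶠ z in 𝓝 ((0 : ℝ), p), 0 < 1 + z.1 * g z.2 := by
      intro g hg
      have hc : ContinuousAt (fun z : ℝ × (ℝ × ℝ) => 1 + z.1 * g z.2) (0, p) := by fun_prop
      exact continuousAt_const.eventually_lt hc (by simp)
    exact (key (fun p => (1 - p.1) * r p.1) (by fun_prop)).and
      ((key (fun p => -(p.1 * r p.1)) (by fun_prop)).and (key _ hq))
  exact h.mono fun t ht x hx y hy => ht (x, y) ⟨hx, hy⟩

section Flow

variable {r : ℝ → ℝ} {q : ℝ → ℝ → ℝ} {t : ℝ}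

/-- This one factorisation controls the interaction term, injectivity, and, as `y → x`, the
Jacobian. -/
theorem endpointFlow_sub (hrq : ∀ x y, x * (1 - x) * r x - y * (1 - y) * r y = (x - y) * q x y)
    (t x y : ℝ) :
    endpointFlow r t x - endpointFlow r t y = (x - y) * (1 + t * q x y) := by
  unfold endpointFlow
  linear_combination t * hrq x y

theorem endpointFlow_eq (r : ℝ → ℝ) (t x : ℝ) :
    endpointFlow r t x = x * (1 + t * ((1 - x) * r x)) := by
  unfold endpointFlow; ring

theorem one_sub_endpointFlow (r : ℝ → ℝ) (t x : ℝ) :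
    1 - endpointFlow r t x = (1 - x) * (1 + t * (-(x * r x))) := by
  unfold endpointFlow; ring

theorem hasDerivAt_endpointFlow
    (hrq : ∀ x y, x * (1 - x) * r x - y * (1 - y) * r y = (x - y) * q x y)
    (hq : Continuous (Function.uncurry q)) (t x : ℝ) :
    HasDerivAt (endpointFlow r t) (1 + t * q x x) x := by
  rw [hasDerivAt_iff_tendsto_slope]
  have hc : Continuous fun y => 1 + t * q y x := by
    have : Continuous fun y => Function.uncurry q (y, x) := hq.comp (by fun_prop)
    exact continuous_const.add (continuous_const.mul this)
  refine ((hc.tendsto x).mono_left nhdsWithin_le_nhds).congr' ?_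
  filter_upwards [self_mem_nhdsWithin] with y hy
  rw [slope_def_field, endpointFlow_sub hrq, mul_div_cancel_left₀ _ (sub_ne_zero.2 hy)]

theorem endpointFlow_mem (ht : IsSmallFlowTime r q t) {x : ℝ} (hx : x ∈ Set.Ioo (0 : ℝ) 1) :
    endpointFlow r t x ∈ Set.Ioo (0 : ℝ) 1 := by
  obtain ⟨h1, h2, -⟩ := ht x (Set.Ioo_subset_Icc_self hx) x (Set.Ioo_subset_Icc_self hx)
  refine ⟨?_, sub_pos.1 ?_⟩
  · rw [endpointFlow_eq]; exact mul_pos hx.1 h1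
  · rw [one_sub_endpointFlow]; exact mul_pos (sub_pos.2 hx.2) h2

theorem image_endpointFlow_openUnitCube (N : ℕ) (ht : IsSmallFlowTime r q t) (hr : Continuous r) :
    (fun (x : Fin N → ℝ) i => endpointFlow r t (x i)) '' openUnitCube N = openUnitCube N := by
  have hc : Continuous (endpointFlow r t) := by unfold endpointFlow; fun_prop
  refine Set.Subset.antisymm ?_ fun y hy => ?_
  · rintro _ ⟨x, hx, rfl⟩
    rw [mem_openUnitCube] at hx ⊢
    exact fun i => endpointFlow_mem ht (hx i)
  · rw [mem_openUnitCube] at hy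
    have hsurj := intermediate_value_Ioo (zero_le_one' ℝ) hc.continuousOn
    have h01 : endpointFlow r t 0 = 0 ∧ endpointFlow r t 1 = 1 := by simp [endpointFlow]
    rw [h01.1, h01.2] at hsurj
    choose x hx hxy using fun i => hsurj (hy i)
    exact ⟨x, mem_openUnitCube.2 hx, funext hxy⟩

theorem injOn_endpointFlow_openUnitCube (N : ℕ) (ht : IsSmallFlowTime r q t)
    (hrq : ∀ x y, x * (1 - x) * r x - y * (1 - y) * r y = (x - y) * q x y) :
    Set.InjOn (fun (x : Fin N → ℝ) i => endpointFlow r t (x i)) (openUnitCube N) := by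
  intro x hx y hy hxy
  rw [mem_openUnitCube] at hx hy
  funext i
  have h := congrFun hxy i
  have h2 := endpointFlow_sub hrq t (x i) (y i)
  have h3 := (ht _ (Set.Ioo_subset_Icc_self (hx i)) _ (Set.Ioo_subset_Icc_self (hy i))).2.2
  simp only at h
  rw [h, sub_self] at h2
  exact sub_eq_zero.1 ((mul_eq_zero.1 h2.symm).resolve_right h3.ne')

theorem jacobiDensity_endpointFlow {N : ℕ} (β a b : ℝ) (ht : IsSmallFlowTime r q t)
    (hrq : ∀ x y, x * (1 - x) * r x - y * (1 - y) * r y = (x - y) * q x y)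
    {x : Fin N → ℝ} (hx : x ∈ openUnitCube N) :
    (∏ i, (1 + t * q (x i) (x i))) * jacobiDensity N β a b (fun i => endpointFlow r t (x i)) =
      jacobiDensity N β a b x * jacobiFlowFactor N β a b r q t x := by
  rw [mem_openUnitCube] at hx
  have hx' : ∀ i, x i ∈ Set.Icc (0 : ℝ) 1 := fun i => Set.Ioo_subset_Icc_self (hx i)
  unfold jacobiDensity jacobiFlowFactor
  have h1 : ∀ i, jacobiWeight a b (endpointFlow r t (x i)) = jacobiWeight a b (x i) *
      ((1 + t * ((1 - x i) * r (x i))) ^ a * (1 + t * (-(x i * r (x i)))) ^ b) := by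
    intro i
    obtain ⟨p1, p2, -⟩ := ht _ (hx' i) _ (hx' i)
    rw [jacobiWeight_of_mem (endpointFlow_mem ht (hx i)), jacobiWeight_of_mem (hx i),
      one_sub_endpointFlow, endpointFlow_eq, Real.mul_rpow (hx i).1.le p1.le,
      Real.mul_rpow (sub_nonneg.2 (hx i).2.le) p2.le]
    ring
  have h2 : ∀ j k, |endpointFlow r t (x k) - endpointFlow r t (x j)| ^ β =
      |x k - x j| ^ β * (1 + t * q (x k) (x j)) ^ β := by
    intro j k
    have p3 := (ht _ (hx' k) _ (hx' j)).2.2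
    rw [endpointFlow_sub hrq, abs_mul, abs_of_pos p3, Real.mul_rpow (abs_nonneg _) p3.le]
  simp only [h1, h2, Finset.prod_mul_distrib]
  ring

/-- Exact change of variables in the Jacobi ensemble. -/
theorem integral_jacobiUnnormalized_endpointFlow (N : ℕ) (β a b : ℝ)
    (ht : IsSmallFlowTime r q t) (hr : Continuous r) (hq : Continuous (Function.uncurry q))
    (hrq : ∀ x y, x * (1 - x) * r x - y * (1 - y) * r y = (x - y) * q x y)
    (F : (Fin N → ℝ) → ℝ) :
    ∫ x, F (fun i => endpointFlow r t (x i)) * jacobiFlowFactor N β a b r q t x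
        ∂jacobiUnnormalized N β a b = ∫ x, F x ∂jacobiUnnormalized N β a b := by
  have hm := (isOpen_openUnitCube N).measurableSet
  have hd : ∀ x ∈ openUnitCube N, HasFDerivWithinAt
      (fun (x : Fin N → ℝ) i => endpointFlow r t (x i))
      (ContinuousLinearMap.pi fun i => (ContinuousLinearMap.toSpanSingleton ℝ
        (1 + t * q (x i) (x i))).comp (ContinuousLinearMap.proj i)) (openUnitCube N) x := by
    intro x _
    refine HasFDerivAt.hasFDerivWithinAt ?_
    rw [hasFDerivAt_pi]
    exact fun i => HasFDerivAt.comp (g := endpointFlow r t) x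
      (hasDerivAt_endpointFlow hrq hq t (x i)).hasFDerivAt (hasFDerivAt_apply i x)
  rw [integral_jacobiUnnormalized, integral_jacobiUnnormalized]
  -- Only the right-hand domain is rewritten as the image of the cube, ready for the Jacobian
  -- formula.
  conv_rhs => rw [← image_endpointFlow_openUnitCube N ht hr]
  rw [integral_image_eq_integral_abs_det_fderiv_smul volume hm hd
    (injOn_endpointFlow_openUnitCube N ht hrq)]
  refine setIntegral_congr_fun hm fun x hx => ?_
  have hpos : 0 < ∏ i, (1 + t * q (x i) (x i)) := Finset.prod_pos fun i _ => by
    have := Set.Ioo_subset_Icc_self (mem_openUnitCube.1 hx i)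
    exact (ht _ this _ this).2.2
  have hdet : (ContinuousLinearMap.pi fun i => (ContinuousLinearMap.toSpanSingleton ℝ
        (1 + t * q (x i) (x i))).comp (ContinuousLinearMap.proj (R := ℝ)
          (φ := fun _ : Fin N => ℝ) i)).det
      = ∏ i, (1 + t * q (x i) (x i)) := by
    rw [ContinuousLinearMap.det_pi]
    simp
  simp only [smul_eq_mul]
  rw [hdet, abs_of_pos hpos]
  linear_combination -(F fun i => endpointFlow r t (x i)) *
    jacobiDensity_endpointFlow β a b ht hrq hx

end Flow

/-! ### Differentiating the change of variables at `t = 0`. -/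

theorem contDiffAt_jacobiFlowFactor {N : ℕ} (β a b : ℝ) {r : ℝ → ℝ} {q : ℝ → ℝ → ℝ}
    (hr : ContDiff ℝ 1 r) (hq : ContDiff ℝ 1 (Function.uncurry q)) (x : Fin N → ℝ) :
    ContDiffAt ℝ 1 (Function.uncurry (jacobiFlowFactor N β a b r q)) (0, x) := by
  have hpow : ∀ (c : ℝ) {g : (Fin N → ℝ) → ℝ}, ContDiff ℝ 1 g →
      ContDiffAt ℝ 1 (fun z : ℝ × (Fin N → ℝ) => (1 + z.1 * g z.2) ^ c) (0, x) := by
    intro c g hg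
    -- The base equals `1` at `t = 0`, so any real exponent is harmless, even on the boundary of the
    -- cube.
    refine ContDiffAt.rpow_const_of_ne ?_ (by simp)
    exact (contDiff_const.add (contDiff_fst.mul (hg.comp contDiff_snd))).contDiffAt
  have hcoord : ∀ i : Fin N, ContDiff ℝ 1 fun y : Fin N → ℝ => y i := fun i => by fun_prop
  have hqc : ∀ i j : Fin N, ContDiff ℝ 1 fun y : Fin N → ℝ => q (y i) (y j) := fun i j =>
    hq.comp ((hcoord i).prodMk (hcoord j))
  have hrc : ∀ i : Fin N, ContDiff ℝ 1 fun y : Fin N → ℝ => r (y i) := fun i =>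
    hr.comp (hcoord i)
  refine ContDiffAt.mul (contDiffAt_prod fun i _ =>
    ((hpow a (g := fun y => (1 - y i) * r (y i)) ?_).mul
      (hpow b (g := fun y => -(y i * r (y i))) ?_)).mul ?_)
    (contDiffAt_prod fun j _ => contDiffAt_prod fun k _ => hpow β (hqc k j))
  · exact (contDiff_const.sub (hcoord i)).mul (hrc i)
  · exact ((hcoord i).mul (hrc i)).neg
  · simpa using hpow 1 (hqc i i)

theorem jacobiFlowFactor_zero (N : ℕ) (β a b : ℝ) (r : ℝ → ℝ) (q : ℝ → ℝ → ℝ) (x : Fin N → ℝ) :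
    jacobiFlowFactor N β a b r q 0 x = 1 := by
  simp [jacobiFlowFactor]

theorem hasDerivAt_jacobiFlowFactor (N : ℕ) (β a b : ℝ) (r : ℝ → ℝ) (q : ℝ → ℝ → ℝ)
    (x : Fin N → ℝ) :
    HasDerivAt (fun t => jacobiFlowFactor N β a b r q t x)
      ((∑ i, (a * ((1 - x i) * r (x i)) - b * (x i * r (x i)) + q (x i) (x i)))
        + β * ∑ j, ∑ k ∈ Finset.Ioi j, q (x k) (x j)) 0 := by
  have hlin : ∀ g : ℝ, HasDerivAt (fun t : ℝ => 1 + t * g) g 0 := fun g => by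
    simpa using ((hasDerivAt_id (0 : ℝ)).mul_const g).const_add 1
  have hpow : ∀ c g : ℝ, HasDerivAt (fun t : ℝ => (1 + t * g) ^ c) (c * g) 0 := fun c g => by
    have := (hlin g).rpow_const (p := c) (Or.inl (by simp))
    simpa [mul_comm] using this
  unfold jacobiFlowFactor
  have h1 : HasDerivAt (fun t : ℝ => ∏ i, (1 + t * ((1 - x i) * r (x i))) ^ a *
      (1 + t * (-(x i * r (x i)))) ^ b * (1 + t * q (x i) (x i)))
      (∑ i, (a * ((1 - x i) * r (x i)) - b * (x i * r (x i)) + q (x i) (x i))) 0 := by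
    refine HasDerivAt.finset_prod_of_eq_one (fun i _ => ?_) (by simp)
    convert! ((hpow a ((1 - x i) * r (x i))).mul (hpow b (-(x i * r (x i))))).mul
      (hlin (q (x i) (x i))) using 1
    simp
    ring
  have h2 : HasDerivAt (fun t : ℝ => ∏ j, ∏ k ∈ Finset.Ioi j, (1 + t * q (x k) (x j)) ^ β)
      (∑ j, ∑ k ∈ Finset.Ioi j, β * q (x k) (x j)) 0 :=
    HasDerivAt.finset_prod_of_eq_one (fun j _ => HasDerivAt.finset_prod_of_eq_one
      (fun k _ => hpow β _) (by simp)) (by simp)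
  convert! h1.mul h2 using 1
  simp [Finset.mul_sum]

/-- The loop equation (integration by parts identity) of the Jacobi ensemble for the vector field
`x (1 - x) r x` applied to every coordinate; `q` is the divided difference of that field, and `F'`
the derivative of `F` along it. -/
theorem jacobi_loop_equation {N : ℕ} {β a b : ℝ} (hβ : 0 ≤ β) (ha : -1 < a) (hb : -1 < b)
    {r : ℝ → ℝ} {q : ℝ → ℝ → ℝ} (hr : ContDiff ℝ 1 r) (hq : ContDiff ℝ 1 (Function.uncurry q))
    (hrq : ∀ x y, x * (1 - x) * r x - y * (1 - y) * r y = (x - y) * q x y)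
    {F F' : (Fin N → ℝ) → ℝ} (hF : ContDiff ℝ 1 F)
    (hF' : ∀ x, HasDerivAt (fun t => F fun i => endpointFlow r t (x i)) (F' x) 0) :
    ∫ x, (F' x + F x * ((∑ i, (a * ((1 - x i) * r (x i)) - b * (x i * r (x i)) + q (x i) (x i)))
        + β * ∑ j, ∑ k ∈ Finset.Ioi j, q (x k) (x j))) ∂jacobiUnnormalized N β a b = 0 := by
  have := isFiniteMeasure_jacobiUnnormalized N hβ ha hb
  have hK : IsCompact (Set.univ.pi fun _ : Fin N => Set.Icc (0 : ℝ) 1) :=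
    isCompact_univ_pi fun _ => isCompact_Icc
  have hμ : ∀ᵐ x ∂jacobiUnnormalized N β a b, x ∈ Set.univ.pi fun _ : Fin N => Set.Icc (0 : ℝ) 1 :=
    (ae_jacobiUnnormalized_mem_openUnitCube N β a b).mono fun x hx i _ =>
      Set.Ioo_subset_Icc_self (mem_openUnitCube.1 hx i)
  have hflow0 : ∀ x : Fin N → ℝ, (fun i => endpointFlow r 0 (x i)) = x := fun x => by
    simp [endpointFlow]
  have key := hasDerivAt_integral_of_contDiffAt_of_isCompact hK hμ
    (G := fun t x => F (fun i => endpointFlow r t (x i)) * jacobiFlowFactor N β a b r q t x)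
    (G' := fun x => F' x + F x * ((∑ i, (a * ((1 - x i) * r (x i)) - b * (x i * r (x i))
      + q (x i) (x i))) + β * ∑ j, ∑ k ∈ Finset.Ioi j, q (x k) (x j)))
    (fun x _ => ?_) (fun x _ => ?_)
  -- By the change of variables the integral is constant for small `t`, so its derivative is also
  -- `0`.
  · refine key.unique ((hasDerivAt_const (0 : ℝ)
      (∫ x, F x ∂jacobiUnnormalized N β a b)).congr_of_eventuallyEq ?_)
    filter_upwards [eventually_isSmallFlowTime hr.continuous hq.continuous] with t ht
    exact integral_jacobiUnnormalized_endpointFlow N β a b ht hr.continuous hq.continuous hrq F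
  · refine ContDiffAt.mul (ContDiff.contDiffAt ?_) (contDiffAt_jacobiFlowFactor β a b hr hq x)
    refine hF.comp (contDiff_pi.2 fun i => ?_)
    unfold endpointFlow
    fun_prop
  · convert! (hF' x).mul (hasDerivAt_jacobiFlowFactor N β a b r q x) using 1
    simp [hflow0, jacobiFlowFactor_zero]

/-! ### The normalised ensemble and loop equations for power sums. -/

theorem isProbabilityMeasure_jacobiEnsemble (N : ℕ) {β a b : ℝ} (hβ : 0 ≤ β) (ha : -1 < a)
    (hb : -1 < b) : IsProbabilityMeasure (jacobiEnsemble N β a b) := by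
  have := isFiniteMeasure_jacobiUnnormalized N hβ ha hb
  refine ⟨?_⟩
  rw [jacobiEnsemble, Measure.smul_apply, smul_eq_mul]
  exact ENNReal.inv_mul_cancel (jacobiUnnormalized_univ_ne_zero N β a b) (measure_ne_top _ _)

theorem integrable_jacobiEnsemble_of_continuous {N : ℕ} {β a b : ℝ} (hβ : 0 ≤ β) (ha : -1 < a)
    (hb : -1 < b) {F : (Fin N → ℝ) → ℝ} (hF : Continuous F) :
    Integrable F (jacobiEnsemble N β a b) := by
  have := isProbabilityMeasure_jacobiEnsemble N hβ ha hb
  have hK : IsCompact (Set.univ.pi fun _ : Fin N => Set.Icc (0 : ℝ) 1) :=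
    isCompact_univ_pi fun _ => isCompact_Icc
  obtain ⟨C, hC⟩ := hK.exists_bound_of_continuousOn hF.continuousOn
  refine Integrable.of_bound hF.aestronglyMeasurable C ?_
  refine Measure.ae_smul_measure
    ((ae_jacobiUnnormalized_mem_openUnitCube N β a b).mono fun x hx => hC x fun i _ => ?_) _
  exact Set.Ioo_subset_Icc_self (mem_openUnitCube.1 hx i)

/-- The power sum `∑ i, x i ^ k`. -/
def realPowerSum {N : ℕ} (k : ℕ) (x : Fin N → ℝ) : ℝ := ∑ i, x i ^ k

@[fun_prop]
theorem contDiff_realPowerSum {N k : ℕ} : ContDiff ℝ 1 (realPowerSum (N := N) k) := by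
  unfold realPowerSum; fun_prop

@[fun_prop]
theorem continuous_realPowerSum {N k : ℕ} : Continuous (realPowerSum (N := N) k) :=
  contDiff_realPowerSum.continuous

theorem hasDerivAt_realPowerSum_endpointFlow {N : ℕ} (k m : ℕ) (x : Fin N → ℝ) :
    HasDerivAt (fun t => realPowerSum k fun i => endpointFlow (fun y => y ^ m) t (x i))
      (k * (realPowerSum (k + m) x - realPowerSum (k + m + 1) x)) 0 := by
  unfold realPowerSum endpointFlow
  have h : ∀ i ∈ Finset.univ, HasDerivAt
      (fun t : ℝ => (x i + t * (x i * (1 - x i) * x i ^ m)) ^ k)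
      (k * (x i ^ (k + m) - x i ^ (k + m + 1))) 0 := by
    intro i _
    have h1 : HasDerivAt (fun t : ℝ => x i + t * (x i * (1 - x i) * x i ^ m))
        (x i * (1 - x i) * x i ^ m) 0 := by
      simpa using ((hasDerivAt_id (0 : ℝ)).mul_const (x i * (1 - x i) * x i ^ m)).const_add (x i)
    convert! h1.pow k using 1
    -- The power rule involves the truncated exponent `k - 1`, hence the separate case `k = 0`.
    rcases k with _ | k
    · simp
    · simp only [Nat.add_sub_cancel, zero_mul, add_zero]
      ring
  convert! HasDerivAt.fun_sum h using 1
  rw [← Finset.sum_sub_distrib, Finset.mul_sum]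

/-- Turns the pair sum of `q` into a full double sum, which is a polynomial in power sums. -/
theorem two_mul_sum_sum_Ioi_of_symm {N : ℕ} (f : Fin N → Fin N → ℝ) (hf : ∀ i j, f i j = f j i) :
    2 * ∑ j, ∑ k ∈ Finset.Ioi j, f k j = ∑ j, ∑ k, f k j - ∑ j, f j j := by
  have h := Finset.sum_sum_Ioi_add_eq_sum_sum_off_diag f
  have h2 : ∀ j, ∑ k ∈ {j}ᶜ, f k j = ∑ k, f k j - f j j := fun j => by
    rw [Finset.compl_singleton, ← Finset.sum_erase_add _ _ (Finset.mem_univ j), add_sub_cancel_right]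
  simp only [h2, Finset.sum_sub_distrib] at h
  rw [← h, Finset.mul_sum]
  refine Finset.sum_congr rfl fun j _ => ?_
  rw [Finset.mul_sum]
  refine Finset.sum_congr rfl fun k _ => ?_
  rw [hf j k]; ring

section LoopEquations

variable {N : ℕ} {β a b : ℝ} {F F' : (Fin N → ℝ) → ℝ}

theorem integral_jacobiEnsemble_eq_zero
    (h : ∫ x, F x ∂jacobiUnnormalized N β a b = 0) : ∫ x, F x ∂jacobiEnsemble N β a b = 0 := by
  rw [jacobiEnsemble, integral_smul_measure, h, smul_zero]

theorem jacobi_loop_equation_zero (hβ : 0 ≤ β) (ha : -1 < a) (hb : -1 < b) (hF : ContDiff ℝ 1 F)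
    (hF' : ∀ x, HasDerivAt (fun t => F fun i => endpointFlow (fun y => y ^ 0) t (x i)) (F' x) 0) :
    ∫ x, (F' x + F x * (N * (β / 2 * (N - 1) + a + 1)
      - (β * (N - 1) + a + b + 2) * realPowerSum 1 x)) ∂jacobiEnsemble N β a b = 0 := by
  refine integral_jacobiEnsemble_eq_zero ?_
  rw [← jacobi_loop_equation hβ ha hb (q := fun x y => 1 - x - y) (by fun_prop)
    (by simp only [Function.uncurry_def]; fun_prop) (fun x y => by ring) hF hF']
  congr 1 with x
  have h := two_mul_sum_sum_Ioi_of_symm (fun k j => 1 - x k - x j) (fun i j => by ring)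
  simp only [Finset.sum_sub_distrib, Finset.sum_add_distrib, Finset.sum_const, Finset.card_univ,
    Fintype.card_fin, nsmul_eq_mul, ← Finset.mul_sum, mul_one, pow_zero] at h ⊢
  simp only [realPowerSum, pow_one]
  linear_combination (-β / 2 * F x) * h

/-- The field is `x² (1 - x)`; the cross term `x y` of its divided difference produces the square of
`realPowerSum 1`. -/
theorem jacobi_loop_equation_one (hβ : 0 ≤ β) (ha : -1 < a) (hb : -1 < b) (hF : ContDiff ℝ 1 F)
    (hF' : ∀ x, HasDerivAt (fun t => F fun i => endpointFlow (fun y => y ^ 1) t (x i)) (F' x) 0) :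
    ∫ x, (F' x + F x * ((a + 2 + β * (N - 1)) * realPowerSum 1 x
      - (a + b + 3 + β / 2 * (2 * N - 3)) * realPowerSum 2 x - β / 2 * realPowerSum 1 x ^ 2))
      ∂jacobiEnsemble N β a b = 0 := by
  refine integral_jacobiEnsemble_eq_zero ?_
  rw [← jacobi_loop_equation hβ ha hb (q := fun x y => x + y - (x ^ 2 + x * y + y ^ 2))
    (by fun_prop) (by simp only [Function.uncurry_def]; fun_prop) (fun x y => by ring) hF hF']
  congr 1 with x
  have h := two_mul_sum_sum_Ioi_of_symm
    (fun k j => x k + x j - (x k ^ 2 + x k * x j + x j ^ 2)) (fun i j => by ring)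
  have h1 : ∀ i, a * ((1 - x i) * x i ^ 1) - b * (x i * x i ^ 1)
      + (x i + x i - (x i ^ 2 + x i * x i + x i ^ 2)) = (a + 2) * x i - (a + b + 3) * x i ^ 2 :=
    fun i => by ring
  have h2 : ∀ i, x i + x i - (x i ^ 2 + x i * x i + x i ^ 2) = 2 * x i - 3 * x i ^ 2 :=
    fun i => by ring
  simp only [h1]
  simp only [h2, Finset.sum_sub_distrib, Finset.sum_add_distrib, Finset.sum_const,
    Finset.card_univ, Fintype.card_fin, nsmul_eq_mul, ← Finset.mul_sum, ← Finset.sum_mul] at h ⊢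
  simp only [realPowerSum, pow_one]
  linear_combination (-β / 2 * F x) * h

end LoopEquations

section Moments

variable {N : ℕ} {β a b : ℝ}

theorem sum_mul_integral_jacobiEnsemble_eq_zero (hβ : 0 ≤ β) (ha : -1 < a) (hb : -1 < b)
    {G : (Fin N → ℝ) → ℝ} (hG : ∫ x, G x ∂jacobiEnsemble N β a b = 0)
    {n : ℕ} (c : Fin n → ℝ) (F : Fin n → (Fin N → ℝ) → ℝ) (hF : ∀ i, Continuous (F i))
    (h : ∀ x, G x = ∑ i, c i * F i x) :
    ∑ i, c i * ∫ x, F i x ∂jacobiEnsemble N β a b = 0 := by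
  rw [← hG, funext h, integral_finsetSum _ fun i _ =>
    (integrable_jacobiEnsemble_of_continuous hβ ha hb (hF i)).const_mul (c i)]
  simp only [integral_const_mul]

/-- The loop equations determining the mixed moments of the power sums of degree at most three. -/
theorem jacobi_powerSum_moment_equations (hβ : 0 ≤ β) (ha : -1 < a) (hb : -1 < b) {u₁ u₂ : ℝ}
    (hu₁ : u₁ = β / 2 * ((N : ℝ) - 1) + a + 1) (hu₂ : u₂ = β * ((N : ℝ) - 1) + a + b + 2)
    {m S Q T R W : ℝ}
    (hm : m = ∫ x, realPowerSum 1 x ∂jacobiEnsemble N β a b)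
    (hS : S = ∫ x, realPowerSum 1 x ^ 2 ∂jacobiEnsemble N β a b)
    (hQ : Q = ∫ x, realPowerSum 2 x ∂jacobiEnsemble N β a b)
    (hT : T = ∫ x, realPowerSum 1 x ^ 3 ∂jacobiEnsemble N β a b)
    (hR : R = ∫ x, realPowerSum 1 x * realPowerSum 2 x ∂jacobiEnsemble N β a b)
    (hW : W = ∫ x, realPowerSum 3 x ∂jacobiEnsemble N β a b) :
    u₂ * m = N * u₁ ∧
    u₂ * S + Q = (N * u₁ + 1) * m ∧
    β / 2 * S + (u₂ + 1 - β / 2) * Q = (u₁ + 1 + β / 2 * (N - 1)) * m ∧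
    u₂ * T + 2 * R = (N * u₁ + 2) * S ∧
    u₂ * R + 2 * W = (N * u₁ + 2) * Q ∧
    β / 2 * T + (u₂ + 1 - β / 2) * R + W = (u₁ + 1 + β / 2 * (N - 1)) * S + Q := by
  have := isProbabilityMeasure_jacobiEnsemble N hβ ha hb
  have hd := fun k m => hasDerivAt_realPowerSum_endpointFlow (N := N) k m
  have hsq : ∀ x, HasDerivAt (fun t => (realPowerSum (N := N) 1 fun i =>
      endpointFlow (fun y => y ^ 0) t (x i)) ^ 2)
      (2 * realPowerSum 1 x * (realPowerSum 1 x - realPowerSum 2 x)) 0 := by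
    intro x
    convert! (hd 1 0 x).pow 2 using 1
    simp [endpointFlow]
  -- The pairs (`r`, `F`) are, in order: (1, 1), (1, p₁), (x, 1), (1, p₁²), (1, p₂), (x, p₁).
  refine ⟨?_, ?_, ?_, ?_, ?_, ?_⟩
  · have h := sum_mul_integral_jacobiEnsemble_eq_zero hβ ha hb
      (jacobi_loop_equation_zero (N := N) hβ ha hb (F := fun _ => 1) (by fun_prop) (fun x => hasDerivAt_const _ _))
      ![N * u₁, -u₂]
      ![fun x => 1, fun x => realPowerSum 1 x]
      (fun i => by fin_cases i <;> simp <;> fun_prop)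
      (fun x => by simp [Fin.sum_univ_succ, hu₁, hu₂]; ring)
    simp [Fin.sum_univ_succ, ← hm] at h
    linarith
  · have h := sum_mul_integral_jacobiEnsemble_eq_zero hβ ha hb
      (jacobi_loop_equation_zero (N := N) hβ ha hb (F := realPowerSum 1) (by fun_prop) (hd 1 0))
      ![N * u₁ + 1, -u₂, -1]
      ![fun x => realPowerSum 1 x, fun x => realPowerSum 1 x ^ 2, fun x => realPowerSum 2 x]
      (fun i => by fin_cases i <;> simp <;> fun_prop)
      (fun x => by simp [Fin.sum_univ_succ, hu₁, hu₂]; ring)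
    simp [Fin.sum_univ_succ, ← hm, ← hS, ← hQ] at h
    linarith
  · have h := sum_mul_integral_jacobiEnsemble_eq_zero hβ ha hb
      (jacobi_loop_equation_one (N := N) hβ ha hb (F := fun _ => 1) (by fun_prop) (fun x => hasDerivAt_const _ _))
      ![u₁ + 1 + β / 2 * (N - 1), -(u₂ + 1 - β / 2), -(β / 2)]
      ![fun x => realPowerSum 1 x, fun x => realPowerSum 2 x, fun x => realPowerSum 1 x ^ 2]
      (fun i => by fin_cases i <;> simp <;> fun_prop)
      (fun x => by simp [Fin.sum_univ_succ, hu₁, hu₂]; ring)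
    simp [Fin.sum_univ_succ, ← hm, ← hQ, ← hS] at h
    linarith
  · have h := sum_mul_integral_jacobiEnsemble_eq_zero hβ ha hb
      (jacobi_loop_equation_zero (N := N) hβ ha hb (F := fun x => realPowerSum 1 x ^ 2) (by fun_prop) (hsq))
      ![N * u₁ + 2, -u₂, -2]
      ![fun x => realPowerSum 1 x ^ 2, fun x => realPowerSum 1 x ^ 3, fun x => realPowerSum 1 x * realPowerSum 2 x]
      (fun i => by fin_cases i <;> simp <;> fun_prop)
      (fun x => by simp [Fin.sum_univ_succ, hu₁, hu₂]; ring)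
    simp [Fin.sum_univ_succ, ← hS, ← hT, ← hR] at h
    linarith
  · have h := sum_mul_integral_jacobiEnsemble_eq_zero hβ ha hb
      (jacobi_loop_equation_zero (N := N) hβ ha hb (F := realPowerSum 2) (by fun_prop) (hd 2 0))
      ![N * u₁ + 2, -u₂, -2]
      ![fun x => realPowerSum 2 x, fun x => realPowerSum 1 x * realPowerSum 2 x, fun x => realPowerSum 3 x]
      (fun i => by fin_cases i <;> simp <;> fun_prop)
      (fun x => by simp [Fin.sum_univ_succ, hu₁, hu₂]; ring)
    simp [Fin.sum_univ_succ, ← hQ, ← hR, ← hW] at h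
    linarith
  · have h := sum_mul_integral_jacobiEnsemble_eq_zero hβ ha hb
      (jacobi_loop_equation_one (N := N) hβ ha hb (F := realPowerSum 1) (by fun_prop) (hd 1 1))
      ![u₁ + 1 + β / 2 * (N - 1), -(u₂ + 1 - β / 2), -(β / 2), 1, -1]
      ![fun x => realPowerSum 1 x ^ 2, fun x => realPowerSum 1 x * realPowerSum 2 x, fun x => realPowerSum 1 x ^ 3, fun x => realPowerSum 2 x, fun x => realPowerSum 3 x]
      (fun i => by fin_cases i <;> simp <;> fun_prop)
      (fun x => by simp [Fin.sum_univ_succ, hu₁, hu₂]; ring)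
    simp [Fin.sum_univ_succ, ← hS, ← hR, ← hT, ← hQ, ← hW] at h
    linarith

end Moments

/-! ### Solving the linear system, with `h` standing for `β / 2`. -/

theorem jacobi_second_moment_of_loop {N h u₁ u₂ m S Q : ℝ} (hh : 1 + h ≠ 0) (h0 : u₂ ≠ 0)
    (h1 : u₂ + 1 ≠ 0) (h2 : u₂ - h ≠ 0) (e1 : u₂ * m = N * u₁)
    (e2 : u₂ * S + Q = (N * u₁ + 1) * m)
    (e3 : h * S + (u₂ + 1 - h) * Q = (u₁ + 1 + h * (N - 1)) * m) :
    S = N * (N - 1) / (1 + h) * (u₁ * (u₁ - h) / (u₂ * (u₂ - h)))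
      + N * (1 + h * N) / (1 + h) * (u₁ * (u₁ + 1) / (u₂ * (u₂ + 1))) := by
  have hm : m = N * u₁ / u₂ := by rw [eq_div_iff h0, mul_comm]; exact e1
  have hS : S = ((N * u₁ + 1) * (u₂ + 1 - h) - (u₁ + 1 + h * (N - 1))) * m
      / ((u₂ + 1) * (u₂ - h)) := by
    rw [eq_div_iff (mul_ne_zero h1 h2)]
    -- This eliminates `Q`; the coefficient of `S`, `u₂ (u₂ + 1 - h) - h`, factors as `(u₂ + 1) (u₂
    -- - h)`.
    linear_combination (u₂ + 1 - h) * e2 - e3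
  rw [hS, hm]
  field_simp
  ring

theorem jacobi_third_moment_of_loop {N h u₁ u₂ m S Q T R W : ℝ} (hh : 1 + h ≠ 0)
    (hh2 : 1 + 2 * h ≠ 0) (hh3 : 1 + h / 2 ≠ 0) (h0 : u₂ ≠ 0) (h1 : u₂ + 1 ≠ 0) (h2 : u₂ + 2 ≠ 0)
    (h3 : u₂ - h ≠ 0) (h4 : u₂ - 2 * h ≠ 0) (e1 : u₂ * m = N * u₁)
    (e2 : u₂ * S + Q = (N * u₁ + 1) * m)
    (e3 : h * S + (u₂ + 1 - h) * Q = (u₁ + 1 + h * (N - 1)) * m)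
    (e4 : u₂ * T + 2 * R = (N * u₁ + 2) * S)
    (e5 : u₂ * R + 2 * W = (N * u₁ + 2) * Q)
    (e6 : h * T + (u₂ + 1 - h) * R + W = (u₁ + 1 + h * (N - 1)) * S + Q) :
    T = N * (N - 1) * (N - 2) / ((1 + h) * (1 + 2 * h))
        * (u₁ * (u₁ - h) * (u₁ - 2 * h) / (u₂ * (u₂ - h) * (u₂ - 2 * h)))
      + 3 * (N * (N - 1) * (1 + h * N) / ((1 + h / 2) * (1 + 2 * h)))
        * (u₁ * (u₁ + 1) * (u₁ - h) / (u₂ * (u₂ + 1) * (u₂ - h)))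
      + N * (1 + h / 2 * N) * (1 + h * N) / ((1 + h / 2) * (1 + h))
        * (u₁ * (u₁ + 1) * (u₁ + 2) / (u₂ * (u₂ + 1) * (u₂ + 2))) := by
  have hS := jacobi_second_moment_of_loop hh h0 h1 h3 e1 e2 e3
  have hm : m = N * u₁ / u₂ := by rw [eq_div_iff h0, mul_comm]; exact e1
  have hQ : Q = (N * u₁ + 1) * m - u₂ * S := by linear_combination e2
  have hT : T = ((N * u₁ + 2) * (u₂ + 2 - 2 * h) * S - 4 * (u₁ + 1 + h * (N - 1)) * S
      + 2 * N * u₁ * Q) / ((u₂ + 2) * (u₂ - 2 * h)) := by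
    rw [eq_div_iff (mul_ne_zero h2 h4)]
    -- The multipliers cancel `R` and `W`; the coefficient of `T` becomes `(u₂ + 2) (u₂ - 2h)`.
    linear_combination (u₂ + 2 - 2 * h) * e4 - 4 * e6 + 2 * e5
  rw [hT, hQ, hS, hm]
  have hh3' : 2 + h ≠ 0 := fun h' => hh3 (by linarith)
  field_simp
  ring

theorem proposition1p1 (N : ℕ) (hN : 1 ≤ N) (β a b : ℝ) (hβ : 0 < β) (ha : -1 < a) (hb : -1 < b)
    (u₁ u₂ : ℝ) (hu₁ : u₁ = (β / 2) * ((N : ℝ) - 1) + a + 1)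
    (hu₂ : u₂ = β * ((N : ℝ) - 1) + a + b + 2) :
    IsProbabilityMeasure (jacobiEnsemble N β a b) ∧
    (∀ k : ℕ, Integrable (fun x : Fin N → ℝ => (∑ j, x j) ^ k) (jacobiEnsemble N β a b)) ∧
    jacobiTraceMoment N β a b 1 = (N : ℝ) * u₁ / u₂ ∧
    jacobiTraceMoment N β a b 2 =
      (N : ℝ) * ((N : ℝ) - 1) / (1 + β / 2)
          * (u₁ * (u₁ - β / 2) / (u₂ * (u₂ - β / 2)))
        + (N : ℝ) * (1 + β * (N : ℝ) / 2) / (1 + β / 2)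
          * (u₁ * (u₁ + 1) / (u₂ * (u₂ + 1))) ∧
    jacobiTraceMoment N β a b 3 =
      (N : ℝ) * ((N : ℝ) - 1) * ((N : ℝ) - 2) / ((1 + β / 2) * (1 + β))
          * (u₁ * (u₁ - β / 2) * (u₁ - β) / (u₂ * (u₂ - β / 2) * (u₂ - β)))
        + 3 * ((N : ℝ) * ((N : ℝ) - 1) * (1 + β * (N : ℝ) / 2) / ((1 + β / 4) * (1 + β)))
          * (u₁ * (u₁ + 1) * (u₁ - β / 2) / (u₂ * (u₂ + 1) * (u₂ - β / 2)))
        + (N : ℝ) * (1 + β * (N : ℝ) / 4) * (1 + β * (N : ℝ) / 2) / ((1 + β / 4) * (1 + β / 2))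
          * (u₁ * (u₁ + 1) * (u₁ + 2) / (u₂ * (u₂ + 1) * (u₂ + 2))) := by
  have hprob := isProbabilityMeasure_jacobiEnsemble N hβ.le ha hb
  obtain ⟨e1, e2, e3, e4, e5, e6⟩ :=
    jacobi_powerSum_moment_equations hβ.le ha hb hu₁ hu₂ rfl rfl rfl rfl rfl rfl
  have hmom : ∀ k, jacobiTraceMoment N β a b k =
      ∫ x, realPowerSum 1 x ^ k ∂jacobiEnsemble N β a b := fun k => by
    simp [jacobiTraceMoment, ProbabilityTheory.moment, realPowerSum]
  have hN' : (1 : ℝ) ≤ N := by exact_mod_cast hN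
  have hpos : 0 < u₂ := by nlinarith
  refine ⟨hprob, fun k => integrable_jacobiEnsemble_of_continuous hβ.le ha hb (by fun_prop), ?_⟩
  rw [hmom, hmom, hmom]
  simp only [pow_one]
  refine ⟨by rw [eq_div_iff hpos.ne', mul_comm]; exact e1, ?_⟩
  -- For `N = 1` every power sum is a power of `x 0`, so `Q = S` and `R = T`, and `e2`, `e4` become
  -- two-term recursions.
  rcases hN.eq_or_lt with h1 | h2
  · subst h1
    have hsum : ∀ (k : ℕ) (x : Fin 1 → ℝ), realPowerSum k x = x 0 ^ k := fun k x => by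
      simp [realPowerSum]
    simp only [hsum, pow_one, Nat.cast_one] at e1 e2 e4 e3 ⊢
    have c3 : ∀ y : ℝ, y * y ^ 2 = y ^ 3 := fun y => by ring
    simp only [c3] at e4
    set m := ∫ x : Fin 1 → ℝ, x 0 ∂jacobiEnsemble 1 β a b
    set S := ∫ x : Fin 1 → ℝ, x 0 ^ 2 ∂jacobiEnsemble 1 β a b
    set T := ∫ x : Fin 1 → ℝ, x 0 ^ 3 ∂jacobiEnsemble 1 β a b
    have hm : m = u₁ / u₂ := by rw [eq_div_iff hpos.ne']; linarith
    have hS : S = (u₁ + 1) * m / (u₂ + 1) := by rw [eq_div_iff (by positivity)]; linarith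
    have hT : T = (u₁ + 2) * S / (u₂ + 2) := by rw [eq_div_iff (by positivity)]; linarith
    have hb1 : 1 + β / 2 ≠ 0 := by positivity
    have hb2 : 1 + β / 4 ≠ 0 := by positivity
    simp only [sub_self, mul_zero, zero_mul, zero_div, zero_add, mul_one, one_mul]
    rw [hT, hS, hm, div_self hb1, mul_comm (1 + β / 4), div_self (by positivity)]
    constructor <;> field_simp
  · have hN2 : (2 : ℝ) ≤ N := by exact_mod_cast h2
    -- Here `u₂ - β = β (N - 2) + (a + 1) + (b + 1)`, and `N ≥ 2`.
    have hpos2 : 0 < u₂ - β := by nlinarith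
    refine ⟨?_, ?_⟩
    · rw [jacobi_second_moment_of_loop (by positivity) hpos.ne' (by positivity)
        (by linarith : 0 < u₂ - β / 2).ne' e1 e2 e3]
      ring
    · rw [jacobi_third_moment_of_loop (by positivity) (by positivity) (by positivity) hpos.ne'
        (by positivity) (by positivity) (by linarith : 0 < u₂ - β / 2).ne'
        (by linarith : 0 < u₂ - 2 * (β / 2)).ne' e1 e2 e3 e4 e5 e6]
      rw [show 2 * (β / 2) = β by ring, show β / 2 / 2 = β / 4 by ring,
        show β / 2 * (N : ℝ) = β * N / 2 by ring, show β / 4 * (N : ℝ) = β * N / 4 by ring]
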